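/- **Setting.** There are $n$ bidders. Bidder $i$ has a private signal $s_i$ in an ordered signal space $S_i$ with least element $0$, and a private monotone valuation function $v_i:\mathbf S=S_1\times\dots\times S_n\to\mathbb R_{\ge 0}$ from a valuation space $V_i$; write $\mathbf V=V_1\times\dots\times V_n$. A valuation $v$ is *$d$-critical* if $|\{j : v(s_{-j},0_j)<v(s)\}|\le d$ for every $s\in\mathbf S$. The sets of bidders that can be served together are the independent sets $\mathcal I$ of a matroid on $[n]$. A mechanism maps reports $(s,v)\in\mathbf S\times\mathbf V$ to a random served set and to payments $p_i(s,v)$; $x_i(s,v)$ denotes the probability that $i$ is served. It is *feasible* if it only ever serves sets in $\mathcal I$. It is *EPIC-IR* if for all $i$, $s\in\mathbf S$, $v\in\mathbf V$, $s_i'\in S_i$, $v_i'\in V_i$, $$x_i(s,v)v_i(s)-p_i(s,v)\ \ge\ x_i(s_{-i},s_i',v_{-i},v_i')\,v_i(s)-p_i(s_{-i},s_i',v_{-i},v_i')\quad\text{and}\quad x_i(s,v)v_i(s)-p_i(s,v)\ge 0 .$$ Its welfare at $(s,v)$ is $\sum_i x_i(s,v)v_i(s)$, and $\mathrm{OPT}(s,v)=\max_{I\in\mathcal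 I}\sum_{i\in I}v_i(s)$. **Candidate Partitioning mechanism.** For weights $w:[n]\to\mathbb R$, let $\mathrm{greedy}(w)$ be the set obtained by going over the bidders by decreasing weight (ties in favour of lower index) and adding each bidder that keeps the set independent. At reports $(s,v)$, for a bidder $i$ and a number $t\ge 0$, let $w_{i,t}(i)=t$ and $w_{i,t}(j)=v_j(s_{-i},0_i)$ for $j\ne i$, and let $\chi_i(t)=\frac1{d+1}$ if $i\in\mathrm{greedy}(w_{i,t})$ and $\chi_i(t)=0$ otherwise. Bidder $i$ is a *candidate* if $i\in \mathrm{greedy}(w_{i,v_i(s)})$. Partition the set $\mathcal C$ of candidates into at most $d+1$ independent sets, serve each of them with probability $\frac1{d+1}$ (and nobody with the remaining probability), and charge $p_i(s,v)=\chi_i(v_i(s))\,v_i(s)-\int_0^{v_i(s)}\chi_i(t)\,dt$. **Theorem.** Let $d\ge 0$, and suppose that every valuation in every $V_i$ is monotone and $d$-critical. Then: 1. For all reports $(s,v)\in\mathbf S\times\mathbf V$, the candidate set can be partitioned into at most $d+1$ independent sets, so the mechanism is well defined. 2. Whichever such partitions are used, the Candidate Partitioning mechanism is feasible, has non-negative payments,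 is EPIC-IR, and is a $(d+1)$-approximation: $\mathrm{OPT}(s,v)\le (d+1)\sum_i x_i(s,v)v_i(s)$ for all $s\in\mathbf S$, $v\in\mathbf V$. 3. The ratio $d+1$ is tight, even for single-item auctions (at most one bidder is served): if $n\ge d+1$ and every signal space has at least two elements, then for every EPIC-IR single-item mechanism for the class of all monotone $d$-critical valuations there are a signal profile $s$ and monotone $d$-critical valuations $v$ with $\mathrm{OPT}(s,v)>0$ and $(d+1)\sum_i x_i(s,v)v_i(s)\le \mathrm{OPT}(s,v)$. -/

import Mathlib

open scoped NNReal

universe u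

namespace InterdependentAuction

/-- Signal profiles. Each signal space is ordered and its least element `⊥` is the zero signal. -/
abbrev SignalProfile {n : ℕ} (S : Fin n → Type u) : Type u := ∀ i, S i

/-- A valuation maps every signal profile to a non-negative value. -/
abbrev Valuation {n : ℕ} (S : Fin n → Type u) : Type u := SignalProfile S → ℝ≥0

section Valuations

variable {n : ℕ} {S : Fin n → Type u} [∀ i, PartialOrder (S i)] [∀ i, OrderBot (S i)]

/-- The profile `(s_{-i}, 0_i)`: the signal of bidder `i` is zeroed out. -/
def zeroOut (s : SignalProfile S) (i : Fin n) : SignalProfile S := Function.update s i ⊥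

/-- At every signal profile, zeroing out one signal lowers the value for at most `d` choices of
the bidder whose signal is zeroed out. -/
def IsCritical (d : ℕ) (v : Valuation S) : Prop :=
  ∀ s : SignalProfile S, (Finset.univ.filter fun j => v (zeroOut s j) < v s).card ≤ d

/-- The class of all monotone `d`-critical valuations. -/
def criticalValuations (S : Fin n → Type u) [∀ i, PartialOrder (S i)] [∀ i, OrderBot (S i)]
    (d : ℕ) : Set (Valuation S) :=
  {v | Monotone v ∧ IsCritical d v}

end Valuations

/-- A (randomized, direct-revelation) mechanism for the signal spaces `S i` and the valuation
spaces `V i`: the reported signals and valuations determine the distribution of the set of bidders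
that is served, and the payment of every bidder. -/
structure Mechanism {n : ℕ} (S : Fin n → Type u) (V : Fin n → Set (Valuation S)) where
  lottery : SignalProfile S → (∀ i, V i) → PMF (Finset (Fin n))
  payment : SignalProfile S → (∀ i, V i) → Fin n → ℝ

namespace Mechanism

variable {n : ℕ} {S : Fin n → Type u} {V : Fin n → Set (Valuation S)}

/-- The probability `x_i(s, v)` that bidder `i` is served. -/
noncomputable def alloc (A : Mechanism S V) (s : SignalProfile S) (v : ∀ i, V i) (i : Fin n) : ℝ :=
  ∑ I : Finset (Fin n) with i ∈ I, (A.lottery s v I).toReal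

/-- Only independent sets of the matroid are ever served. -/
def IsFeasible (A : Mechanism S V) (M : Matroid (Fin n)) : Prop :=
  ∀ s v, ∀ I ∈ (A.lottery s v).support, M.Indep (I : Set (Fin n))

/-- Ex-post incentive compatibility: no bidder `i` gains by reporting `(si, vi)` instead of her
true signal and valuation when all others report truthfully. -/
def IsEPIC (A : Mechanism S V) : Prop :=
  ∀ (i : Fin n) (s : SignalProfile S) (v : ∀ i, V i) (si : S i) (vi : V i),
    A.alloc (Function.update s i si) (Function.update v i vi) i * ((v i).1 s : ℝ)
        - A.payment (Function.update s i si) (Function.update v i vi) i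
      ≤ A.alloc s v i * ((v i).1 s : ℝ) - A.payment s v i

/-- Ex-post individual rationality. -/
def IsIR (A : Mechanism S V) : Prop :=
  ∀ (i : Fin n) (s : SignalProfile S) (v : ∀ i, V i),
    0 ≤ A.alloc s v i * ((v i).1 s : ℝ) - A.payment s v i

/-- Ex-post incentive compatible and individually rational. -/
def IsEPICIR (A : Mechanism S V) : Prop := A.IsEPIC ∧ A.IsIR

/-- The expected social welfare at truthful reports. -/
noncomputable def welfare (A : Mechanism S V) (s : SignalProfile S) (v : ∀ i, V i) : ℝ :=
  ∑ i, A.alloc s v i * ((v i).1 s : ℝ)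

end Mechanism

open Classical in
/-- The optimal welfare: the maximum total value of an independent set. -/
noncomputable def optWelfare {n : ℕ} {S : Fin n → Type u} {V : Fin n → Set (Valuation S)}
    (M : Matroid (Fin n)) (s : SignalProfile S) (v : ∀ i, V i) : ℝ≥0 :=
  (Finset.univ.filter fun I : Finset (Fin n) => M.Indep (I : Set (Fin n))).sup
    fun I => ∑ i ∈ I, (v i).1 s

/-- `A` is an `α`-approximation to the optimal welfare. -/
def Mechanism.IsApprox {n : ℕ} {S : Fin n → Type u} {V : Fin n → Set (Valuation S)}
    (A : Mechanism S V) (M : Matroid (Fin n)) (α : ℝ) : Prop :=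
  ∀ s v, (optWelfare M s v : ℝ) ≤ α * A.welfare s v

section Greedy

variable {n : ℕ}

/-- `i` is considered no later than `j`: decreasing weights, ties in favour of lower indices. -/
def Precedes (w : Fin n → ℝ) (i j : Fin n) : Prop := w j < w i ∨ (w i = w j ∧ i ≤ j)

open Classical in
/-- The greedy algorithm on the matroid `M` with weights `w`. -/
noncomputable def greedy (M : Matroid (Fin n)) (w : Fin n → ℝ) : Finset (Fin n) :=
  ((List.finRange n).insertionSort (Precedes w)).foldl
    (fun I j => if M.Indep (insert j (I : Set (Fin n))) then insert j I else I) ∅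

end Greedy

section CandidatePartitioning

variable {n : ℕ} {S : Fin n → Type u} [∀ i, PartialOrder (S i)] [∀ i, OrderBot (S i)]
  {V : Fin n → Set (Valuation S)}

/-- The weights used to examine bidder `i`: the number `t` for bidder `i` herself, and the shadow
value `v_j(s_{-i}, 0_i)` for every other bidder `j`. -/
noncomputable def examWeight (s : SignalProfile S) (v : ∀ i, V i) (i : Fin n) (t : ℝ) :
    Fin n → ℝ :=
  fun j => if j = i then t else ((v j).1 (zeroOut s i) : ℝ)

open Classical in
/-- The candidates: the bidders `i` selected by greedy when `i` is weighted by her real value and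
all others by their shadow values. -/
noncomputable def candidates (M : Matroid (Fin n)) (s : SignalProfile S) (v : ∀ i, V i) :
    Finset (Fin n) :=
  Finset.univ.filter fun i => i ∈ greedy M (examWeight s v i ((v i).1 s))

/-- `P` is a partition of the candidates into at most `d + 1` independent sets, written as a family
of exactly `d + 1` pairwise disjoint independent sets, some of which may be empty. -/
structure IsCandidatePartition (d : ℕ) (M : Matroid (Fin n)) (s : SignalProfile S) (v : ∀ i, V i)
    (P : Fin (d + 1) → Finset (Fin n)) : Prop where
  indep : ∀ k, M.Indep (P k : Set (Fin n))
  disjoint : Pairwise fun k l => Disjoint (P k) (P l)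
  cover : Finset.univ.biUnion P = candidates M s v

open Classical in
/-- The allocation probability `x_i(s_{-i}, v_{-i}, t)` of bidder `i` in the Candidate Partitioning
mechanism as a function of her value `t`: it is `1 / (d + 1)` if value `t` makes her a candidate. -/
noncomputable def candidateAlloc (d : ℕ) (M : Matroid (Fin n)) (s : SignalProfile S) (v : ∀ i, V i)
    (i : Fin n) (t : ℝ) : ℝ :=
  if i ∈ greedy M (examWeight s v i t) then 1 / ((d : ℝ) + 1) else 0

/-- The payment `x_i(v_i(s)) * v_i(s) - ∫_0^{v_i(s)} x_i(t) dt`. -/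
noncomputable def candidatePayment (d : ℕ) (M : Matroid (Fin n)) (s : SignalProfile S)
    (v : ∀ i, V i) (i : Fin n) : ℝ :=
  candidateAlloc d M s v i ((v i).1 s) * ((v i).1 s : ℝ)
    - ∫ t in (0 : ℝ)..((v i).1 s : ℝ), candidateAlloc d M s v i t

/-- The Candidate Partitioning mechanism, where `P s v` is the partition of the candidates that is
found at the reports `(s, v)`: each of the `d + 1` sets, the empty ones serving nobody, is served
with probability `1 / (d + 1)`. -/
noncomputable def candidatePartitioning (d : ℕ) (M : Matroid (Fin n))
    (P : SignalProfile S → (∀ i, V i) → Fin (d + 1) → Finset (Fin n)) : Mechanism S V where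
  lottery s v := (PMF.uniformOfFintype (Fin (d + 1))).map (P s v)
  payment s v i := candidatePayment d M s v i

end CandidatePartitioning

/-- The matroid of a single-item auction: at most one bidder can be served. -/
def singleItem (n : ℕ) : Matroid (Fin n) :=
  (IndepMatroid.ofFinset Set.univ (fun I : Finset (Fin n) => I.card ≤ 1)
    (by simp)
    (fun _ _ hJ hIJ => (Finset.card_le_card hIJ).trans hJ)
    (fun I J _ hJ hIJ => by
      obtain ⟨e, he, he'⟩ := Finset.exists_mem_notMem_of_card_lt_card hIJ
      refine ⟨e, he, he', ?_⟩
      have := Finset.card_insert_le e I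
      omega)
    (fun _ _ => Set.subset_univ _)).matroid

end InterdependentAuction

/-! Greedy on `M` selects `i` exactly when `i` is not spanned by the elements considered before `i`.
Hence raising the weight of `i` and lowering the others keeps `i` selected, which gives two things.
The allocation of a bidder is monotone in her value, so that Myerson's payments make truth-telling
optimal. Every bidder that greedy selects under the real values is a candidate, so that the
candidates are worth at least `OPT`.

For the partition, order the bidders as greedy does under the real values `v_j(s)` and join `j` to
the later `i` if zeroing the signal of `i` lowers `v_j(s)`. Every bidder is joined to at most `d`
later ones, so the bidders can be coloured with `d + 1` colours, starting from the last one. A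
candidate `i` is not spanned by the earlier bidders of her own colour, because these still come
before `i` when they are weighted by their shadow values, and so colour classes are independent.

For tightness, give each of `d + 1` bidders the value `1` if all the others among them have a
nonzero signal, and `0` otherwise. At a profile of nonzero signals one of them, `i`, is served with
probability at most `1 / (d + 1)`, and incentive compatibility keeps it so when her type changes to
the signal `0` and the constant value `1 / 2`. Then she alone has a positive value. -/

namespace InterdependentAuction

section Matroid

variable {α β : Type*} {M : Matroid α}

lemma indep_of_forall_notMem_closure [LinearOrder β] {I : Set α} {f : α → β} (hfin : I.Finite)
    (hf : I.InjOn f) (hIE : I ⊆ M.E) (h : ∀ i ∈ I, i ∉ M.closure {j ∈ I | f j < f i}) :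
    M.Indep I := by
  by_contra hI
  obtain ⟨C, hCI, hC⟩ := ((M.not_indep_iff hIE).1 hI).exists_isCircuit_subset
  obtain ⟨e, he, hmax⟩ := Set.exists_max_image C f (hfin.subset hCI) hC.nonempty
  refine h e (hCI he) (M.closure_subset_closure ?_ (hC.mem_closure_sdiff_singleton_of_mem he))
  rintro j ⟨hj, hje⟩
  exact ⟨hCI hj, (hmax j hj).lt_of_ne fun hfj => hje (hf (hCI hj) (hCI he) hfj)⟩

lemma card_le_card_of_subset_closure {I J : Finset α} (hI : M.Indep I)
    (hIJ : (I : Set α) ⊆ M.closure J) : I.card ≤ J.card := by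
  have h : (I : Set α).encard ≤ (J : Set α).encard :=
    calc (I : Set α).encard ≤ M.eRk (M.closure J) := hI.encard_le_eRk_of_subset hIJ
      _ = M.eRk J := M.eRk_closure_eq J
      _ ≤ (J : Set α).encard := M.eRk_le_encard J
  simpa using h

lemma exists_injective_of_mem_closure {I : Finset α} (hI : M.Indep I)
    (t : I → Finset α) (ht : ∀ i, i.1 ∈ M.closure (t i)) :
    ∃ f : I → α, f.Injective ∧ ∀ i, f i ∈ t i := by
  classical
  refine (Finset.all_card_le_biUnion_card_iff_exists_injective t).1 fun A => ?_
  rw [← Finset.card_map (Function.Embedding.subtype _) (s := A)]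
  refine card_le_card_of_subset_closure (M := M) (hI.subset fun i hi => ?_) fun i hi => ?_
  · obtain ⟨a, -, rfl⟩ := Finset.mem_map.1 hi
    exact a.2
  · obtain ⟨a, ha, rfl⟩ := Finset.mem_map.1 hi
    have hsub : t a ⊆ A.biUnion t := Finset.subset_biUnion_of_mem t ha
    exact M.closure_subset_closure (Finset.coe_subset.2 hsub) (ht a)

lemma sum_le_sum_of_mem_closure [AddCommMonoid β] [Preorder β] [IsOrderedAddMonoid β]
    {w : α → β} {I J : Finset α} (hI : M.Indep I) (hw : ∀ j ∈ J, 0 ≤ w j)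
    (h : ∀ i ∈ I, i ∈ M.closure {j | j ∈ J ∧ w i ≤ w j}) :
    ∑ i ∈ I, w i ≤ ∑ j ∈ J, w j := by
  classical
  obtain ⟨f, hf, hfJ⟩ := exists_injective_of_mem_closure hI
    (fun i => J.filter fun j => w i ≤ w j) (by simpa using h)
  simp only [Finset.mem_filter] at hfJ
  calc ∑ i ∈ I, w i = ∑ i : I, w i := (Finset.sum_coe_sort I w).symm
    _ ≤ ∑ i : I, w (f i) := Finset.sum_le_sum fun i _ => (hfJ i).2
    _ = ∑ j ∈ Finset.univ.image f, w j := (Finset.sum_image hf.injOn).symm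
    _ ≤ ∑ j ∈ J, w j := Finset.sum_le_sum_of_subset_of_nonneg
        (Finset.image_subset_iff.2 fun i _ => (hfJ i).1) fun j hj _ => hw j hj

end Matroid

section Coloring

variable {α β : Type*} [Finite α] [LinearOrder β] {d : ℕ} {D : α → Finset α}

lemma exists_coloring_of_card_le (f : α → β) (hD : ∀ j, (D j).card ≤ d) :
    ∃ c : α → Fin (d + 1), ∀ j i, f j < f i → i ∈ D j → c j ≠ c i := by
  classical
  cases nonempty_fintype α
  suffices h : ∀ s : Finset α, ∃ c : α → Fin (d + 1),
      ∀ j ∈ s, ∀ i ∈ s, f j < f i → i ∈ D j → c j ≠ c i by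
    simpa using h Finset.univ
  intro s
  induction s using Finset.induction_on_min_value f with
  | empty => exact ⟨fun _ => 0, by simp⟩
  | insert a s has hmin ih =>
    obtain ⟨c, hc⟩ := ih
    obtain ⟨k, hk⟩ : ∃ k, k ∉ (D a).image c := by
      refine (Finset.exists_mem_notMem_of_card_lt_card (t := Finset.univ) ?_).imp fun _ => And.right
      simpa [Nat.lt_succ_iff] using Finset.card_image_le.trans (hD a)
    refine ⟨Function.update c a k, fun j hj i hi hji hiD => ?_⟩
    have hia : i ≠ a := by
      rintro rfl
      rcases Finset.mem_insert.1 hj with rfl | hj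
      · exact hji.false
      · exact (hmin j hj).not_gt hji
    have his : i ∈ s := Finset.mem_of_mem_insert_of_ne hi hia
    rw [Function.update_of_ne hia]
    rcases eq_or_ne j a with rfl | hja
    · rw [Function.update_self]
      rintro rfl
      exact hk (Finset.mem_image_of_mem c hiD)
    · rw [Function.update_of_ne hja]
      exact hc j (Finset.mem_of_mem_insert_of_ne hj hja) i his hji hiD

lemma exists_coloring_indep {M : Matroid α} {f : α → β} {C : Set α} (hf : C.InjOn f)
    (hD : ∀ j, (D j).card ≤ d) (hCE : C ⊆ M.E)
    (hC : ∀ i ∈ C, i ∉ M.closure {j ∈ C | f j < f i ∧ i ∉ D j}) :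
    ∃ c : α → Fin (d + 1), ∀ k, M.Indep {i ∈ C | c i = k} := by
  obtain ⟨c, hc⟩ := exists_coloring_of_card_le f hD
  refine ⟨c, fun k => ?_⟩
  refine indep_of_forall_notMem_closure (Set.toFinite _) (hf.mono (Set.sep_subset _ _))
    (fun i hi => hCE hi.1) fun i hi hcl => hC i hi.1 (M.closure_subset_closure ?_ hcl)
  rintro j ⟨hj, hji⟩
  exact ⟨hj.1, hji, fun hiD => hc j i hji hiD (hj.2.trans hi.2.symm)⟩

end Coloring

section GreedyList

variable {α β : Type*} [DecidableEq α] {M : Matroid α}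

open Classical in
/-- The set built by the greedy algorithm on the matroid `M` when the elements of the list `l` are
considered in the order of the list. -/
noncomputable def greedyList (M : Matroid α) (l : List α) : Finset α :=
  l.foldl (fun I j => if M.Indep (insert j (I : Set α)) then insert j I else I) ∅

@[simp]
lemma greedyList_nil : greedyList M [] = ∅ := rfl

open Classical in
lemma greedyList_concat (l : List α) (a : α) :
    greedyList M (l ++ [a]) =
      if M.Indep (insert a (greedyList M l : Set α)) then insert a (greedyList M l)
      else greedyList M l := by
  rw [greedyList, List.foldl_append]
  rfl

lemma indep_greedyList (l : List α) : M.Indep (greedyList M l : Set α) := by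
  induction l using List.reverseRecOn with
  | nil => simp
  | append_singleton l a ih =>
    rw [greedyList_concat]
    split_ifs with h
    · simpa using h
    · exact ih

lemma mem_of_mem_greedyList {l : List α} {i : α} (hi : i ∈ greedyList M l) : i ∈ l := by
  induction l using List.reverseRecOn with
  | nil => simp at hi
  | append_singleton l a ih =>
    rw [greedyList_concat] at hi
    grind

lemma closure_greedyList (l : List α) : M.closure (greedyList M l) = M.closure {j | j ∈ l} := by
  induction l using List.reverseRecOn with
  | nil => simp
  | append_singleton l a ih =>
    have hset : {j | j ∈ l ++ [a]} = insert a {j | j ∈ l} := by ext j; simp [or_comm]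
    rw [hset, ← M.closure_insert_congr_right ih, greedyList_concat]
    split_ifs with h
    · rw [Finset.coe_insert]
    · by_cases ha : a ∈ M.E
      · refine (M.closure_insert_eq_of_mem_closure ?_).symm
        by_contra hcl
        exact h (((indep_greedyList l).notMem_closure_iff ha).1 hcl).1
      · rw [← M.closure_inter_ground (insert a _), Set.insert_inter_of_notMem ha,
          M.closure_inter_ground]

lemma mem_greedyList_iff [Preorder β] {f : α → β} {l : List α} (hl : l.Pairwise (f · < f ·))
    {i : α} (hi : i ∈ l) :
    i ∈ greedyList M l ↔ i ∈ M.E ∧ i ∉ M.closure {j ∈ {j | j ∈ l} | f j < f i} := by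
  induction l using List.reverseRecOn with
  | nil => simp at hi
  | append_singleton l a ih =>
    obtain ⟨hl, -, hla⟩ := List.pairwise_append.1 hl
    replace hla : ∀ j ∈ l, f j < f a := fun j hj => hla j hj a (List.mem_singleton_self a)
    rcases List.mem_append.1 hi with hi | hi
    · have hset : {j ∈ {j | j ∈ l ++ [a]} | f j < f i} = {j ∈ {j | j ∈ l} | f j < f i} := by
        ext j
        have := hla i hi
        grind
      have hia : i ≠ a := fun h => (hla i hi).ne (congrArg f h)
      rw [hset, ← ih hl hi, greedyList_concat]
      split_ifs <;> simp [hia]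
    · obtain rfl := List.mem_singleton.1 hi
      have hset : {j ∈ {j | j ∈ l ++ [i]} | f j < f i} = {j | j ∈ l} := by
        ext j
        grind
      have hil : i ∉ greedyList M l := fun h => (hla i (mem_of_mem_greedyList h)).false
      rw [hset, ← closure_greedyList, ← Set.mem_sdiff,
        ← (indep_greedyList l).insert_indep_iff_of_notMem (Finset.mem_coe.not.2 hil),
        greedyList_concat]
      split_ifs with h <;> simp [h, hil]

end GreedyList

section Greedy

variable {n : ℕ} {M : Matroid (Fin n)} {w w' : Fin n → ℝ} {i j : Fin n}

/-- The key by which the greedy algorithm sorts the bidders: decreasing weights, ties in favour of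
lower indices. -/
def greedyKey (w : Fin n → ℝ) (i : Fin n) : ℝᵒᵈ ×ₗ Fin n := toLex (OrderDual.toDual (w i), i)

lemma greedyKey_injective (w : Fin n → ℝ) : Function.Injective (greedyKey w) := fun _ _ h =>
  congrArg (fun x => (ofLex x).2) h

lemma precedes_iff_greedyKey_le : Precedes w i j ↔ greedyKey w i ≤ greedyKey w j := by
  simp [Precedes, greedyKey, Prod.Lex.toLex_le_toLex]

lemma greedyKey_anti (h : w i ≤ w' i) : greedyKey w' i ≤ greedyKey w i :=
  Prod.Lex.toLex_mono ⟨OrderDual.toDual_le_toDual.2 h, le_rfl⟩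

lemma le_of_greedyKey_le (h : greedyKey w i ≤ greedyKey w j) : w j ≤ w i :=
  (precedes_iff_greedyKey_le.2 h).elim le_of_lt fun h => h.1.ge

lemma exists_greedy_eq_greedyList (M : Matroid (Fin n)) (w : Fin n → ℝ) :
    ∃ l : List (Fin n), greedy M w = greedyList M l ∧ (∀ i, i ∈ l) ∧
      l.Pairwise (greedyKey w · < greedyKey w ·) := by
  classical
  have : Std.Total (Precedes w) := ⟨fun a b => by
    simpa only [precedes_iff_greedyKey_le] using le_total _ _⟩
  have : IsTrans (Fin n) (Precedes w) := ⟨fun a b c => by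
    simpa only [precedes_iff_greedyKey_le] using le_trans⟩
  refine ⟨(List.finRange n).insertionSort (Precedes w), ?_,
    fun i => (List.mem_insertionSort _).2 (List.mem_finRange i), ?_⟩
  · unfold greedy greedyList
    congr!
  · have hnodup : ((List.finRange n).insertionSort (Precedes w)).Nodup :=
      (List.perm_insertionSort _ _).nodup_iff.2 (List.nodup_finRange n)
    refine ((List.pairwise_insertionSort (Precedes w) _).and hnodup).imp fun ⟨hle, hne⟩ => ?_
    exact (precedes_iff_greedyKey_le.1 hle).lt_of_ne ((greedyKey_injective w).ne hne)

lemma mem_greedy_iff :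
    i ∈ greedy M w ↔ i ∈ M.E ∧ i ∉ M.closure {j | greedyKey w j < greedyKey w i} := by
  obtain ⟨l, hg, hmem, hl⟩ := exists_greedy_eq_greedyList M w
  simpa [hg, hmem] using mem_greedyList_iff hl (hmem i)

lemma mem_closure_greedy (hi : i ∈ M.E) :
    i ∈ M.closure {j | j ∈ greedy M w ∧ greedyKey w j ≤ greedyKey w i} := by
  by_contra hcl
  obtain ⟨i, ⟨hi, hcl⟩, hmin⟩ := Set.exists_min_image
    {i | i ∈ M.E ∧ i ∉ M.closure {j | j ∈ greedy M w ∧ greedyKey w j ≤ greedyKey w i}}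
    (greedyKey w) (Set.toFinite _) ⟨i, hi, hcl⟩
  have hig : i ∉ greedy M w := fun h => hcl (M.mem_closure_of_mem' ⟨h, le_rfl⟩ hi)
  have hspan : i ∈ M.closure ({j | greedyKey w j < greedyKey w i} ∩ M.E) := by
    rw [M.closure_inter_ground]
    by_contra h
    exact hig (mem_greedy_iff.2 ⟨hi, h⟩)
  refine hcl (M.closure_subset_closure_of_subset_closure ?_ hspan)
  rintro j ⟨hji : greedyKey w j < greedyKey w i, hj⟩
  have hj' : j ∈ M.closure {k | k ∈ greedy M w ∧ greedyKey w k ≤ greedyKey w j} := by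
    by_contra h
    exact (hmin j ⟨hj, h⟩).not_gt hji
  refine M.closure_subset_closure ?_ hj'
  rintro k ⟨hk, hkj⟩
  exact ⟨hk, hkj.trans hji.le⟩

lemma sum_le_sum_greedy (hw : ∀ i, 0 ≤ w i) {I : Finset (Fin n)} (hI : M.Indep I) :
    ∑ i ∈ I, w i ≤ ∑ i ∈ greedy M w, w i := by
  refine sum_le_sum_of_mem_closure hI (fun i _ => hw i) fun i hi => ?_
  refine M.closure_subset_closure ?_ (mem_closure_greedy (w := w) (hI.subset_ground hi))
  rintro j ⟨hj, hji⟩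
  exact ⟨hj, le_of_greedyKey_le hji⟩

lemma mem_greedy_of_le (hi : w i ≤ w' i) (hj : ∀ j, j ≠ i → w' j ≤ w j)
    (h : i ∈ greedy M w) : i ∈ greedy M w' := by
  rw [mem_greedy_iff] at h ⊢
  refine ⟨h.1, fun hcl => h.2 (M.closure_subset_closure ?_ hcl)⟩
  intro j (hji : greedyKey w' j < greedyKey w' i)
  have hne : j ≠ i := fun h => hji.ne (congrArg (greedyKey w') h)
  exact (greedyKey_anti (hj j hne)).trans_lt (hji.trans_le (greedyKey_anti hi))

end Greedy

section Mechanism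

variable {n : ℕ} {S : Fin n → Type u} {V : Fin n → Set (Valuation S)}

lemma sum_le_optWelfare {M : Matroid (Fin n)} {I : Finset (Fin n)} (hI : M.Indep I)
    (s : SignalProfile S) (v : ∀ i, V i) : ∑ i ∈ I, (v i).1 s ≤ optWelfare M s v := by
  classical
  exact Finset.le_sup (f := fun I => ∑ i ∈ I, (v i).1 s)
    (Finset.mem_filter.2 ⟨Finset.mem_univ I, hI⟩)

namespace Mechanism

variable {A : Mechanism S V} {s : SignalProfile S} {v : ∀ i, V i}

lemma alloc_nonneg (A : Mechanism S V) (s : SignalProfile S) (v : ∀ i, V i) (i : Fin n) :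
    0 ≤ A.alloc s v i :=
  Finset.sum_nonneg fun _ _ => ENNReal.toReal_nonneg

lemma alloc_eq_toOuterMeasure (A : Mechanism S V) (s : SignalProfile S) (v : ∀ i, V i)
    (i : Fin n) : A.alloc s v i = ((A.lottery s v).toOuterMeasure {I | i ∈ I}).toReal := by
  rw [← Finset.coe_filter_univ, PMF.toOuterMeasure_apply_finset,
    ENNReal.toReal_sum fun I _ => PMF.apply_ne_top _ I]
  rfl

lemma alloc_eq_card_div_card {κ : Type*} [Fintype κ] [Nonempty κ] {P : κ → Finset (Fin n)}
    (h : A.lottery s v = (PMF.uniformOfFintype κ).map P) (i : Fin n) :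
    A.alloc s v i = (Finset.univ.filter fun k => i ∈ P k).card / Fintype.card κ := by
  classical
  rw [alloc_eq_toOuterMeasure, h, PMF.toOuterMeasure_map_apply,
    PMF.toOuterMeasure_uniformOfFintype_apply]
  simp [Fintype.card_subtype]

lemma sum_alloc (A : Mechanism S V) (s : SignalProfile S) (v : ∀ i, V i) :
    ∑ i, A.alloc s v i = ∑ I, (A.lottery s v I).toReal * I.card := by
  calc ∑ i, A.alloc s v i
      = ∑ I : Finset (Fin n), ∑ _i ∈ I, (A.lottery s v I).toReal := by
        unfold alloc
        exact Finset.sum_comm' (by simp)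
    _ = ∑ I, (A.lottery s v I).toReal * I.card := by
        simp only [Finset.sum_const, nsmul_eq_mul, mul_comm]

end Mechanism

end Mechanism

section Myerson

variable {n : ℕ} {S : Fin n → Type u} {V : Fin n → Set (Valuation S)}

lemma mul_sub_le_integral_of_monotone {f : ℝ → ℝ} (hf : Monotone f) (a b : ℝ) :
    f a * (b - a) ≤ ∫ t in a..b, f t := by
  rcases le_total a b with hab | hab
  · calc f a * (b - a) = ∫ _ in a..b, f a := by simp [mul_comm]
      _ ≤ ∫ t in a..b, f t := intervalIntegral.integral_mono_on hab
          intervalIntegrable_const hf.intervalIntegrable fun t ht => hf ht.1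
  · have h : ∫ t in b..a, f t ≤ ∫ _ in b..a, f a := intervalIntegral.integral_mono_on hab
      hf.intervalIntegrable intervalIntegrable_const fun t ht => hf ht.2
    rw [intervalIntegral.integral_symm]
    simp only [intervalIntegral.integral_const, smul_eq_mul] at h
    linarith

namespace Mechanism

/-- `A` serves bidder `i` with the probability `χ s v i t` that belongs to her value `t = v_i(s)`
and charges Myerson's payments, where the curve `χ s v i` is non-negative and monotone and does not
depend on the report of `i` herself. -/
structure IsMyerson (A : Mechanism S V)
    (χ : SignalProfile S → (∀ i, V i) → Fin n → ℝ → ℝ) : Prop where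
  nonneg : ∀ s v i t, 0 ≤ χ s v i t
  monotone : ∀ s v i, Monotone (χ s v i)
  update : ∀ s v i (a : S i) (b : V i),
    χ (Function.update s i a) (Function.update v i b) i = χ s v i
  alloc_eq : ∀ s v i, A.alloc s v i = χ s v i ((v i).1 s)
  payment_eq : ∀ s v i, A.payment s v i =
    χ s v i ((v i).1 s) * ((v i).1 s : ℝ) - ∫ t in (0 : ℝ)..((v i).1 s : ℝ), χ s v i t

namespace IsMyerson

variable {A : Mechanism S V} {χ : SignalProfile S → (∀ i, V i) → Fin n → ℝ → ℝ}

lemma payment_nonneg (h : A.IsMyerson χ) (s : SignalProfile S) (v : ∀ i, V i) (i : Fin n) :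
    0 ≤ A.payment s v i := by
  have hint := mul_sub_le_integral_of_monotone (h.monotone s v i) ((v i).1 s) 0
  rw [intervalIntegral.integral_symm] at hint
  rw [h.payment_eq]
  linarith

lemma isIR (h : A.IsMyerson χ) : A.IsIR := fun i s v => by
  rw [h.alloc_eq, h.payment_eq, sub_sub_cancel]
  exact intervalIntegral.integral_nonneg (NNReal.coe_nonneg _) fun t _ => h.nonneg s v i t

lemma isEPIC (h : A.IsMyerson χ) : A.IsEPIC := fun i s v a b => by
  simp only [h.alloc_eq, h.payment_eq, h.update]
  set t : ℝ := ((v i).1 s : ℝ)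
  set t' : ℝ := ((Function.update v i b i).1 (Function.update s i a) : ℝ)
  have hmono := h.monotone s v i
  have hloss : χ s v i t' * (t - t') ≤ ∫ τ in t'..t, χ s v i τ :=
    mul_sub_le_integral_of_monotone hmono t' t
  have hsplit : (∫ τ in (0 : ℝ)..t', χ s v i τ) + ∫ τ in t'..t, χ s v i τ =
      ∫ τ in (0 : ℝ)..t, χ s v i τ :=
    intervalIntegral.integral_add_adjacent_intervals hmono.intervalIntegrable
      hmono.intervalIntegrable
  linarith

end IsMyerson

end Mechanism

end Myerson

section Candidates

variable {n d : ℕ} {S : Fin n → Type u} [∀ i, PartialOrder (S i)] [∀ i, OrderBot (S i)]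
  {V : Fin n → Set (Valuation S)} {M : Matroid (Fin n)} {s : SignalProfile S} {v : ∀ i, V i}
  {i j : Fin n}

lemma zeroOut_le (s : SignalProfile S) (i : Fin n) : zeroOut s i ≤ s :=
  update_le_self_iff.2 bot_le

@[simp]
lemma zeroOut_update (s : SignalProfile S) (i : Fin n) (a : S i) :
    zeroOut (Function.update s i a) i = zeroOut s i :=
  Function.update_idem ..

@[simp]
lemma examWeight_self (s : SignalProfile S) (v : ∀ i, V i) (i : Fin n) (t : ℝ) :
    examWeight s v i t i = t :=
  if_pos rfl

lemma examWeight_of_ne (s : SignalProfile S) (v : ∀ i, V i) (h : j ≠ i) (t : ℝ) :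
    examWeight s v i t j = (v j).1 (zeroOut s i) :=
  if_neg h

lemma examWeight_update (s : SignalProfile S) (v : ∀ i, V i) (i : Fin n) (a : S i) (b : V i)
    (t : ℝ) :
    examWeight (Function.update s i a) (Function.update v i b) i t = examWeight s v i t := by
  ext j
  rcases eq_or_ne j i with rfl | hj
  · simp
  · simp [examWeight_of_ne _ _ hj, hj]

lemma mem_candidates :
    i ∈ candidates M s v ↔ i ∈ greedy M (examWeight s v i ((v i).1 s)) := by
  simp [candidates]

lemma exists_isCandidatePartition (hv : ∀ i, IsCritical d (v i).1) :
    ∃ P, IsCandidatePartition d M s v P := by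
  let w : Fin n → ℝ := fun j => (v j).1 s
  let D : Fin n → Finset (Fin n) := fun j =>
    Finset.univ.filter fun i => (v j).1 (zeroOut s i) < (v j).1 s
  have hcandidate : ∀ i ∈ candidates M s v, i ∈ M.E ∧
      i ∉ M.closure {j ∈ candidates M s v | greedyKey w j < greedyKey w i ∧ i ∉ D j} := by
    intro i hi
    rw [mem_candidates, mem_greedy_iff] at hi
    refine ⟨hi.1, fun hcl => hi.2 (M.closure_subset_closure ?_ hcl)⟩
    rintro j ⟨-, hji, hij⟩
    have hne : j ≠ i := fun h => hji.ne (congrArg (greedyKey w) h)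
    have hshadow : w j ≤ examWeight s v i ((v i).1 s) j := by
      rw [examWeight_of_ne s v hne]
      exact_mod_cast not_lt.1 fun hlt => hij (by simpa [D, w] using hlt)
    exact (greedyKey_anti hshadow).trans_lt
      (hji.trans_le (greedyKey_anti (examWeight_self ..).le))
  obtain ⟨c, hc⟩ := exists_coloring_indep (greedyKey_injective w).injOn (fun j => hv j s)
    (fun i hi => (hcandidate i hi).1) fun i hi => (hcandidate i hi).2
  refine ⟨fun k => (candidates M s v).filter fun i => c i = k, fun k => ?_, fun k l hkl => ?_, ?_⟩
  · simpa using hc k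
  · exact Finset.disjoint_filter.2 fun i _ hk hl => hkl (hk.symm.trans hl)
  · ext i
    simp

lemma optWelfare_le_sum_candidates (hv : ∀ j i, (v j).1 (zeroOut s i) ≤ (v j).1 s) :
    optWelfare M s v ≤ ∑ i ∈ candidates M s v, (v i).1 s := by
  classical
  refine Finset.sup_le fun I hI => ?_
  have hgreedy : ∑ i ∈ I, (v i).1 s ≤ ∑ i ∈ greedy M (fun i => ((v i).1 s : ℝ)), (v i).1 s := by
    exact_mod_cast sum_le_sum_greedy (fun i => NNReal.coe_nonneg ((v i).1 s))
      (Finset.mem_filter.1 hI).2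
  refine hgreedy.trans (Finset.sum_le_sum_of_subset fun i hi => mem_candidates.2 ?_)
  refine mem_greedy_of_le (examWeight_self ..).ge (fun j hj => ?_) hi
  rw [examWeight_of_ne s v hj]
  exact_mod_cast hv j i

lemma IsCandidatePartition.card_filter_mem {P : Fin (d + 1) → Finset (Fin n)}
    (hP : IsCandidatePartition d M s v P) (i : Fin n) :
    (Finset.univ.filter fun k => i ∈ P k).card = if i ∈ candidates M s v then 1 else 0 := by
  have hmem : i ∈ candidates M s v ↔ ∃ k, i ∈ P k := by simp [← hP.cover]
  split_ifs with h
  · obtain ⟨k, hk⟩ := hmem.1 h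
    refine Finset.card_eq_one.2 ⟨k, Finset.ext fun l => ?_⟩
    simp only [Finset.mem_filter_univ, Finset.mem_singleton]
    refine ⟨fun hl => ?_, fun hl => hl ▸ hk⟩
    by_contra hlk
    exact Finset.disjoint_left.1 (hP.disjoint hlk) hl hk
  · simpa [Finset.filter_eq_empty_iff] using hmem.not.1 h

lemma candidateAlloc_nonneg (s : SignalProfile S) (v : ∀ i, V i) (i : Fin n) (t : ℝ) :
    0 ≤ candidateAlloc d M s v i t := by
  unfold candidateAlloc
  split_ifs <;> positivity

lemma candidateAlloc_monotone (s : SignalProfile S) (v : ∀ i, V i) (i : Fin n) :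
    Monotone (candidateAlloc d M s v i) := by
  intro t t' htt'
  by_cases h : i ∈ greedy M (examWeight s v i t)
  · have h' : i ∈ greedy M (examWeight s v i t') :=
      mem_greedy_of_le (by simpa using htt') (fun j hj => by simp [examWeight_of_ne s v hj]) h
    simp only [candidateAlloc, if_pos h, if_pos h', le_refl]
  · rw [candidateAlloc, if_neg h]
    exact candidateAlloc_nonneg s v i t'

variable {P : SignalProfile S → (∀ i, V i) → Fin (d + 1) → Finset (Fin n)}

lemma candidatePartitioning_alloc (hP : IsCandidatePartition d M s v (P s v)) (i : Fin n) :
    (candidatePartitioning d M P).alloc s v i =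
      if i ∈ candidates M s v then 1 / ((d : ℝ) + 1) else 0 := by
  rw [Mechanism.alloc_eq_card_div_card (κ := Fin (d + 1)) (P := P s v) rfl,
    hP.card_filter_mem, Fintype.card_fin]
  split_ifs <;> simp

lemma candidatePartitioning_isMyerson (hP : ∀ s v, IsCandidatePartition d M s v (P s v)) :
    (candidatePartitioning d M P).IsMyerson (candidateAlloc d M) where
  nonneg := candidateAlloc_nonneg
  monotone := candidateAlloc_monotone
  update s v i a b := by
    ext t
    simp only [candidateAlloc, examWeight_update]
  alloc_eq s v i := by
    simp only [candidatePartitioning_alloc (hP s v), mem_candidates, candidateAlloc]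
  payment_eq _ _ _ := rfl

lemma candidatePartitioning_isFeasible (hP : ∀ s v, IsCandidatePartition d M s v (P s v)) :
    (candidatePartitioning d M P).IsFeasible M := by
  intro s v I hI
  obtain ⟨k, -, rfl⟩ := (PMF.mem_support_map_iff _ _ _).1 hI
  exact (hP s v).indep k

lemma candidatePartitioning_isApprox (hV : ∀ i, ∀ u ∈ V i, ∀ s j, u (zeroOut s j) ≤ u s)
    (hP : ∀ s v, IsCandidatePartition d M s v (P s v)) :
    (candidatePartitioning d M P).IsApprox M (d + 1) := by
  intro s v
  calc (optWelfare M s v : ℝ)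
      ≤ ∑ i ∈ candidates M s v, ((v i).1 s : ℝ) := by
        exact_mod_cast optWelfare_le_sum_candidates fun j i => hV j (v j).1 (v j).2 s i
    _ = (d + 1) * (candidatePartitioning d M P).welfare s v := by
        simp only [Mechanism.welfare, candidatePartitioning_alloc (hP s v), ite_mul, zero_mul,
          Finset.sum_ite_mem, Finset.univ_inter, ← Finset.mul_sum]
        field_simp

end Candidates

section SingleItem

variable {n : ℕ} {S : Fin n → Type u} {V : Fin n → Set (Valuation S)} {A : Mechanism S V}
  {T : Finset (Fin n)}

lemma singleItem_indep_iff {I : Finset (Fin n)} :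
    (singleItem n).Indep (I : Set (Fin n)) ↔ I.card ≤ 1 :=
  ⟨fun h => h I subset_rfl, fun h _ hJ => (Finset.card_le_card (Finset.coe_subset.1 hJ)).trans h⟩

lemma le_optWelfare_singleItem (s : SignalProfile S) (v : ∀ i, V i) (i : Fin n) :
    (v i).1 s ≤ optWelfare (singleItem n) s v := by
  simpa using sum_le_optWelfare (singleItem_indep_iff.2 (Finset.card_singleton i).le) s v

namespace Mechanism

lemma sum_alloc_le_one (hA : A.IsFeasible (singleItem n)) (s : SignalProfile S)
    (v : ∀ i, V i) : ∑ i, A.alloc s v i ≤ 1 := by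
  calc ∑ i, A.alloc s v i
      = ∑ I, (A.lottery s v I).toReal * I.card := A.sum_alloc s v
    _ ≤ ∑ I, (A.lottery s v I).toReal := by
        refine Finset.sum_le_sum fun I _ => ?_
        by_cases hI : A.lottery s v I = 0
        · simp [hI]
        · have hcard : I.card ≤ 1 :=
            singleItem_indep_iff.1 (hA s v I ((PMF.mem_support_iff _ _).2 hI))
          exact mul_le_of_le_one_right ENNReal.toReal_nonneg (Nat.cast_le_one.2 hcard)
    _ = 1 := by
        rw [← ENNReal.toReal_sum fun I _ => PMF.apply_ne_top _ I,
          ← tsum_fintype (L := .unconditional _), PMF.tsum_coe, ENNReal.toReal_one]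

lemma exists_card_mul_alloc_le_one (hA : A.IsFeasible (singleItem n)) (hT : T.Nonempty)
    (s : SignalProfile S) (v : ∀ i, V i) : ∃ i ∈ T, T.card * A.alloc s v i ≤ 1 := by
  refine Finset.exists_le_of_sum_le hT ?_
  calc ∑ i ∈ T, T.card * A.alloc s v i
      = T.card * ∑ i ∈ T, A.alloc s v i := (Finset.mul_sum ..).symm
    _ ≤ T.card * ∑ i, A.alloc s v i := by
        gcongr
        · exact fun i _ _ => A.alloc_nonneg s v i
        · exact T.subset_univ
    _ ≤ T.card * 1 := by gcongr; exact sum_alloc_le_one hA s v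
    _ = ∑ _i ∈ T, 1 := by simp

lemma IsEPIC.alloc_update_le (hA : A.IsEPIC) {i : Fin n} {s : SignalProfile S} {v : ∀ i, V i}
    {a : S i} {b : V i} (h : b.1 (Function.update s i a) < (v i).1 s) :
    A.alloc (Function.update s i a) (Function.update v i b) i ≤ A.alloc s v i := by
  have hdown := hA i s v a b
  have hup := hA i (Function.update s i a) (Function.update v i b) (s i) (v i)
  simp only [Function.update_idem, Function.update_eq_self, Function.update_self] at hup
  have hgap : (0 : ℝ) < (v i).1 s - b.1 (Function.update s i a) :=
    sub_pos.2 (NNReal.coe_lt_coe.2 h)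
  refine le_of_mul_le_mul_right ?_ hgap
  linarith

lemma IsEPIC.exists_card_mul_welfare_le (hA : A.IsEPIC) (hF : A.IsFeasible (singleItem n))
    (hT : T.Nonempty) {s : SignalProfile S} {v : ∀ i, V i} {a : ∀ i, S i} {b : ∀ i, V i}
    (hpos : ∀ i ∈ T, 0 < (b i).1 (Function.update s i (a i)))
    (hlt : ∀ i ∈ T, (b i).1 (Function.update s i (a i)) < (v i).1 s)
    (hzero : ∀ i ∈ T, ∀ j ≠ i, (v j).1 (Function.update s i (a i)) = 0) :
    ∃ s v, 0 < optWelfare (singleItem n) s v ∧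
      T.card * A.welfare s v ≤ optWelfare (singleItem n) s v := by
  obtain ⟨i, hi, halloc⟩ := exists_card_mul_alloc_le_one hF hT s v
  let s' := Function.update s i (a i)
  let v' := Function.update v i (b i)
  have hself : v' i = b i := Function.update_self ..
  have hbopt : (b i).1 s' ≤ optWelfare (singleItem n) s' v' :=
    hself ▸ le_optWelfare_singleItem s' v' i
  have hwelfare : A.welfare s' v' = A.alloc s' v' i * (b i).1 s' := by
    rw [← hself]
    refine Finset.sum_eq_single i (fun j _ hj => ?_) (by simp)
    have hother : v' j = v j := Function.update_of_ne hj ..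
    rw [hother, hzero i hi j hj, NNReal.coe_zero, mul_zero]
  refine ⟨s', v', (hpos i hi).trans_le hbopt, ?_⟩
  calc T.card * A.welfare s' v'
      = T.card * A.alloc s' v' i * (b i).1 s' := by rw [hwelfare, mul_assoc]
    _ ≤ T.card * A.alloc s v i * (b i).1 s' := by gcongr; exact hA.alloc_update_le (hlt i hi)
    _ ≤ (b i).1 s' := mul_le_of_le_one_left (NNReal.coe_nonneg _) halloc
    _ ≤ optWelfare (singleItem n) s' v' := NNReal.coe_le_coe.2 hbopt

end Mechanism

end SingleItem

section Tightness

variable {n d : ℕ} {S : Fin n → Type u} [∀ i, PartialOrder (S i)] [∀ i, OrderBot (S i)]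
  {T : Finset (Fin n)} {s : SignalProfile S} {i j : Fin n}

lemma isCritical_of_forall_notMem {v : Valuation S} (hT : T.card ≤ d)
    (h : ∀ s, ∀ j ∉ T, v s ≤ v (zeroOut s j)) : IsCritical d v := fun s =>
  (Finset.card_le_card fun j hj => by
    by_contra hjT
    exact (Finset.mem_filter.1 hj).2.not_ge (h s j hjT)).trans hT

lemma const_mem_criticalValuations (d : ℕ) (c : ℝ≥0) : (fun _ => c) ∈ criticalValuations S d :=
  ⟨monotone_const, isCritical_of_forall_notMem (T := ∅) (Nat.zero_le d) fun _ _ _ => le_rfl⟩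

open Classical in
/-- The valuation of bidder `i` in the instance that shows tightness: if `i ∈ T`, her value is `1`
when all other bidders of `T` have a nonzero signal and `0` otherwise; bidders outside `T` have no
value. -/
noncomputable def hardValuation (T : Finset (Fin n)) (i : Fin n) : Valuation S := fun s =>
  if i ∈ T ∧ ∀ j ∈ T.erase i, s j ≠ ⊥ then 1 else 0

lemma hardValuation_eq_one (hi : i ∈ T) (hs : ∀ j ∈ T, s j ≠ ⊥) : hardValuation T i s = 1 :=
  if_pos ⟨hi, fun j hj => hs j (Finset.mem_of_mem_erase hj)⟩

lemma hardValuation_eq_zero (hj : j ∈ T) (hji : j ≠ i) (hs : s j = ⊥) : hardValuation T i s = 0 :=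
  if_neg fun h => h.2 j (Finset.mem_erase.2 ⟨hji, hj⟩) hs

lemma hardValuation_le_of_imp {s' : SignalProfile S} (h : ∀ j ∈ T.erase i, s j ≠ ⊥ → s' j ≠ ⊥) :
    hardValuation T i s ≤ hardValuation T i s' := by
  unfold hardValuation
  split_ifs with hs hs'
  · exact le_rfl
  · exact absurd ⟨hs.1, fun j hj => h j hj (hs.2 j hj)⟩ hs'
  all_goals exact zero_le

lemma monotone_hardValuation (T : Finset (Fin n)) (i : Fin n) :
    Monotone (hardValuation T i : Valuation S) := fun _ _ hs =>
  hardValuation_le_of_imp fun j _ hj => ne_bot_of_le_ne_bot hj (hs j)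

lemma isCritical_hardValuation (hT : T.card ≤ d + 1) (i : Fin n) :
    IsCritical d (hardValuation T i : Valuation S) := by
  by_cases hi : i ∈ T
  · refine isCritical_of_forall_notMem (T := T.erase i) ?_ fun s j hj =>
      hardValuation_le_of_imp fun k hk hsk => ?_
    · rw [Finset.card_erase_of_mem hi]
      omega
    · have hkj : k ≠ j := ne_of_mem_of_not_mem hk hj
      rwa [zeroOut, Function.update_of_ne hkj]
  · refine isCritical_of_forall_notMem (T := ∅) (Nat.zero_le d) fun s j _ => ?_
    exact (if_neg fun h => hi h.1).trans_le zero_le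

lemma exists_succ_mul_welfare_le_optWelfare (hT : T.card = d + 1) (hS : ∀ i ∈ T, Nontrivial (S i))
    {A : Mechanism S fun _ => criticalValuations S d} (hF : A.IsFeasible (singleItem n))
    (hA : A.IsEPIC) :
    ∃ s v, 0 < optWelfare (singleItem n) s v ∧
      ((d : ℝ) + 1) * A.welfare s v ≤ optWelfare (singleItem n) s v := by
  have hsignal : ∀ i, ∃ a : S i, i ∈ T → a ≠ ⊥ := fun i => by
    by_cases hi : i ∈ T
    · have := hS i hi
      exact (exists_ne ⊥).imp fun _ h _ => h
    · exact ⟨⊥, fun h => absurd h hi⟩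
  choose s hs using hsignal
  have h := hA.exists_card_mul_welfare_le hF (T := T) (Finset.card_pos.1 (by omega))
    (s := s) (v := fun i => ⟨hardValuation T i, monotone_hardValuation T i,
      isCritical_hardValuation hT.le i⟩)
    (a := fun _ => ⊥) (b := fun _ => ⟨fun _ => 1 / 2, const_mem_criticalValuations d _⟩)
    (fun _ _ => by norm_num)
    (fun i hi => by simpa only [hardValuation_eq_one hi hs] using NNReal.half_lt_self one_ne_zero)
    (fun i hi j hj => hardValuation_eq_zero hi hj.symm (Function.update_self ..))
  exact_mod_cast hT ▸ h

end Tightness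

end InterdependentAuction

open InterdependentAuction in
theorem theorem4p1_general (d n : ℕ) (S : Fin n → Type u)
    [∀ i, PartialOrder (S i)] [∀ i, OrderBot (S i)]
    (V : Fin n → Set (Valuation S)) (M : Matroid (Fin n)) :
    ((∀ i, ∀ u ∈ V i, IsCritical d u) →
      ∀ (s : SignalProfile S) (v : ∀ i, V i), ∃ P, IsCandidatePartition d M s v P) ∧
    (∀ P : SignalProfile S → (∀ i, V i) → Fin (d + 1) → Finset (Fin n),
      (∀ s v, IsCandidatePartition d M s v (P s v)) →
        (candidatePartitioning d M P).IsFeasible M ∧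
        (∀ s v i, 0 ≤ (candidatePartitioning d M P).payment s v i) ∧
        (candidatePartitioning d M P).IsEPICIR ∧
        ((∀ i, ∀ u ∈ V i, ∀ s j, u (zeroOut s j) ≤ u s) →
          (candidatePartitioning d M P).IsApprox M (d + 1))) ∧
    (∀ T : Finset (Fin n), d + 1 ≤ T.card → (∀ i ∈ T, Nontrivial (S i)) →
      ∀ A : Mechanism S (fun _ => criticalValuations S d),
        A.IsFeasible (singleItem n) → A.IsEPIC →
          ∃ s v, 0 < optWelfare (singleItem n) s v ∧
            ((d : ℝ) + 1) * A.welfare s v ≤ optWelfare (singleItem n) s v) := by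
  refine ⟨fun hV s v => exists_isCandidatePartition fun i => hV i (v i).1 (v i).2,
    fun P hP => ?_, fun T hT hS A hF hA => ?_⟩
  · have hMyerson := candidatePartitioning_isMyerson hP
    exact ⟨candidatePartitioning_isFeasible hP, hMyerson.payment_nonneg,
      ⟨hMyerson.isEPIC, hMyerson.isIR⟩, fun hV => candidatePartitioning_isApprox hV hP⟩
  · obtain ⟨T', hT'T, hT'⟩ := Finset.exists_subset_card_eq hT
    exact exists_succ_mul_welfare_le_optWelfare hT' (fun i hi => hS i (hT'T hi)) hF hA

open InterdependentAuction in
theorem theorem4p1 (d n : ℕ) (S : Fin n → Type u)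
    [∀ i, PartialOrder (S i)] [∀ i, OrderBot (S i)]
    (V : Fin n → Set (Valuation S)) (hV : ∀ i, V i ⊆ criticalValuations S d)
    (M : Matroid (Fin n)) :
    -- the mechanism is well defined: the candidates can always be partitioned as required
    (∀ (s : SignalProfile S) (v : ∀ i, V i), ∃ P, IsCandidatePartition d M s v P) ∧
    -- whichever partitions are used, it is feasible, EPIC-IR and a `(d + 1)`-approximation
    (∀ P : SignalProfile S → (∀ i, V i) → Fin (d + 1) → Finset (Fin n),
      (∀ s v, IsCandidatePartition d M s v (P s v)) →
        (candidatePartitioning d M P).IsFeasible M ∧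
        (∀ s v i, 0 ≤ (candidatePartitioning d M P).payment s v i) ∧
        (candidatePartitioning d M P).IsEPICIR ∧
        (candidatePartitioning d M P).IsApprox M (d + 1)) ∧
    -- tightness: no EPIC-IR single-item auction for `d`-critical valuations has a better ratio
    (d + 1 ≤ n → (∀ i, Nontrivial (S i)) →
      ∀ A : Mechanism S (fun _ => criticalValuations S d),
        A.IsFeasible (singleItem n) → A.IsEPICIR →
          ∃ s v, 0 < optWelfare (singleItem n) s v ∧
            ((d : ℝ) + 1) * A.welfare s v ≤ optWelfare (singleItem n) s v) :=
  have h := theorem4p1_general d n S V M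
  ⟨h.1 fun i u hu => (hV i hu).2,
    fun P hP => (h.2.1 P hP).imp_right <| .imp_right <| .imp_right fun happrox =>
      happrox fun i u hu s j => (hV i hu).1 (zeroOut_le s j),
    fun hdn hS A hF hA => h.2.2 Finset.univ (by simpa using hdn) (fun i _ => hS i) A hF hA.1⟩
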